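/- All sequences are indexed by $n\in\mathbb N$ and all scalars are real. Let $(p_n)$ be a sequence in $[1,\infty)$. For a real sequence $a=(a_n)$ let $$\|a\|_{(p_n)}=\inf\Big\{t>0:\ \sum_n |a_n/t|^{p_n}\le 1\Big\},$$ let $\ell_{(p_n)}$ be the Nakano space of all real sequences $a$ with $\sum_n|a_n/t|^{p_n}<\infty$ for some $t>0$, normed by $\|\cdot\|_{(p_n)}$, and let $h_{(p_n)}$ be the closed linear span of the unit vectors in $\ell_{(p_n)}$. Let $c_0$ be the space of real sequences tending to $0$, with the supremum norm. A Schauder basis $(e_n)$ of a space $X$, with coordinate functionals $(e_n^*)$, is called a *greedy basis* if it is seminormalized, i.e. $0<\inf_n\|e_n\|\le\sup_n\|e_n\|<\infty$, and there is a constant $C$ such that for all $x\in X$, all $N$, all $N$-element sets $\Lambda$ of indices with $|e_n^*(x)|\ge|e_m^*(x)|$ whenever $n\in\Lambda$, $m\notin\Lambda$, all $N$-element sets $A$ of indices and all real $(\alpha_n)_{n\in A}$, $$\Big\|x-\sum_{n\in\Lambda}e_n^*(x)e_n\Big\|\le C\,\Big\|x-\sum_{n\in A}\alpha_ne_n\Big\|.$$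 A *greedy basic sequence* is a sequence that is a greedy basis of its closed linear span. Sequences $(x_n)$ and $(y_n)$ in normed spaces are *equivalent* if there is $C\ge1$ with $C^{-1}\|\sum_{n\le N}a_nx_n\|\le\|\sum_{n\le N}a_ny_n\|\le C\|\sum_{n\le N}a_nx_n\|$ for all $N$ and all scalars $(a_n)$. **Theorem.** Suppose $p_n\in[1,\infty)$ for all $n$ and $\lim_n p_n=\infty$. Then: (a) Every greedy basic sequence in $h_{(p_n)}$ is equivalent to the unit vector basis of $c_0$. (b) A closed subspace of $h_{(p_n)}$ has a greedy basis if and only if it is isomorphic (linearly homeomorphic) to $c_0$. (c) The space $h_{(p_n)}$ has a greedy basis if and only if $h_{(p_n)}=c_0$ as sets of sequences; in that case the norms of $h_{(p_n)}$ and $c_0$ are equivalent. -/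

import Mathlib

open Filter Topology ZeroAtInfty
open scoped ENNReal

/-! ### Nakano sequence spaces -/

section NakanoSpaces

/-- The Nakano modular `∑ₙ |aₙ| ^ pₙ ∈ [0, ∞]` of a real sequence `a`. -/
noncomputable def nakanoModular (p : ℕ → ℝ) (a : ℕ → ℝ) : ℝ≥0∞ :=
  ∑' n, ENNReal.ofReal (|a n| ^ p n)

theorem nakanoModular_mono {p : ℕ → ℝ} (hp : ∀ n, 1 ≤ p n) {a b : ℕ → ℝ}
    (h : ∀ n, |a n| ≤ |b n|) : nakanoModular p a ≤ nakanoModular p b :=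
  ENNReal.tsum_le_tsum fun n => ENNReal.ofReal_le_ofReal
    (Real.rpow_le_rpow (abs_nonneg _) (h n) (zero_le_one.trans (hp n)))

theorem nakanoModular_convex {p : ℕ → ℝ} (hp : ∀ n, 1 ≤ p n) (a b : ℕ → ℝ) {s t : ℝ}
    (hs : 0 ≤ s) (ht : 0 ≤ t) (hst : s + t = 1) :
    nakanoModular p (s • a + t • b) ≤
      ENNReal.ofReal s * nakanoModular p a + ENNReal.ofReal t * nakanoModular p b := by
  unfold nakanoModular
  rw [← ENNReal.tsum_mul_left, ← ENNReal.tsum_mul_left, ← ENNReal.tsum_add]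
  refine ENNReal.tsum_le_tsum fun n => ?_
  rw [← ENNReal.ofReal_mul hs, ← ENNReal.ofReal_mul ht, ← ENNReal.ofReal_add (by positivity)
    (by positivity)]
  refine ENNReal.ofReal_le_ofReal ?_
  have h1 : |(s • a + t • b) n| ≤ s * |a n| + t * |b n| := by
    simp only [Pi.add_apply, Pi.smul_apply, smul_eq_mul]
    refine (abs_add_le _ _).trans ?_
    rw [abs_mul, abs_mul, abs_of_nonneg hs, abs_of_nonneg ht]
  have h2 := (convexOn_rpow (hp n)).2 (Set.mem_Ici.2 (abs_nonneg (a n)))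
    (Set.mem_Ici.2 (abs_nonneg (b n))) hs ht hst
  simp only [smul_eq_mul] at h2
  exact (Real.rpow_le_rpow (abs_nonneg _) h1 (zero_le_one.trans (hp n))).trans h2

theorem nakanoModular_zero {p : ℕ → ℝ} (hp : ∀ n, 1 ≤ p n) : nakanoModular p 0 = 0 := by
  unfold nakanoModular
  refine ENNReal.tsum_eq_zero.2 fun n => ?_
  have : p n ≠ 0 := by linarith [hp n]
  simp [Real.zero_rpow this]

theorem nakanoModular_smul_le {p : ℕ → ℝ} (hp : ∀ n, 1 ≤ p n) (a : ℕ → ℝ) {s : ℝ}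
    (hs : 0 ≤ s) (hs1 : s ≤ 1) :
    nakanoModular p (s • a) ≤ ENNReal.ofReal s * nakanoModular p a := by
  have h := nakanoModular_convex hp a 0 hs (sub_nonneg.2 hs1) (by ring)
  simpa [nakanoModular_zero hp] using h

theorem nakanoModular_neg (p a : ℕ → ℝ) : nakanoModular p (-a) = nakanoModular p a := by
  simp [nakanoModular]

/-- The sequences `a` with `∑ₙ |aₙ / t| ^ pₙ < ∞` for some `t > 0`, as a space of sequences. -/
def nakanoSubmodule (p : ℕ → ℝ) (hp : ∀ n, 1 ≤ p n) : Submodule ℝ (ℕ → ℝ) where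
  carrier := {a | ∃ t : ℝ, 0 < t ∧ nakanoModular p (fun n => a n / t) < ∞}
  zero_mem' := ⟨1, one_pos, by
    have : (fun n => (0 : ℕ → ℝ) n / 1) = 0 := by ext; simp
    rw [this, nakanoModular_zero hp]; exact ENNReal.zero_lt_top⟩
  add_mem' := by
    rintro a b ⟨s, hs, ha⟩ ⟨t, ht, hb⟩
    refine ⟨s + t, by positivity, ?_⟩
    have key : (fun n => (a + b) n / (s + t)) =
        (s / (s + t)) • (fun n => a n / s) + (t / (s + t)) • (fun n => b n / t) := by
      ext n
      simp only [Pi.add_apply, Pi.smul_apply, smul_eq_mul]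
      field_simp
    rw [key]
    refine (nakanoModular_convex hp _ _ (by positivity) (by positivity)
      (by field_simp)).trans_lt ?_
    exact ENNReal.add_lt_top.2 ⟨ENNReal.mul_lt_top ENNReal.ofReal_lt_top ha,
      ENNReal.mul_lt_top ENNReal.ofReal_lt_top hb⟩
  smul_mem' := by
    rintro c a ⟨t, ht, ha⟩
    refine ⟨t * (|c| + 1), by positivity, (nakanoModular_mono hp fun n => ?_).trans_lt ha⟩
    have hc : (0 : ℝ) < |c| + 1 := by positivity
    simp only [Pi.smul_apply, smul_eq_mul, abs_div, abs_mul, abs_of_pos ht, abs_of_pos hc]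
    rw [div_le_div_iff₀ (by positivity) ht]
    nlinarith [abs_nonneg c, abs_nonneg (a n), mul_nonneg (abs_nonneg (a n)) ht.le]

/-- The (full) Nakano space `ℓ_(pₙ)`; it carries the Luxemburg norm defined below. -/
def NakanoSpace (p : ℕ → ℝ) (hp : ∀ n, 1 ≤ p n) : Type := nakanoSubmodule p hp

variable {p : ℕ → ℝ} {hp : ∀ n, 1 ≤ p n}

noncomputable instance : AddCommGroup (NakanoSpace p hp) :=
  inferInstanceAs (AddCommGroup (nakanoSubmodule p hp))

noncomputable instance : Module ℝ (NakanoSpace p hp) :=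
  inferInstanceAs (Module ℝ (nakanoSubmodule p hp))

/-- Elements of `ℓ_(pₙ)` are sequences. -/
instance : CoeFun (NakanoSpace p hp) (fun _ => ℕ → ℝ) := ⟨Subtype.val⟩

/-- The norm `‖a‖ = inf {t > 0 : ∑ₙ |aₙ / t| ^ pₙ ≤ 1}`. -/
noncomputable instance : Norm (NakanoSpace p hp) :=
  ⟨fun a => sInf {t : ℝ | 0 < t ∧ nakanoModular p (fun n => a n / t) ≤ 1}⟩

theorem NakanoSpace.norm_def (a : NakanoSpace p hp) :
    ‖a‖ = sInf {t : ℝ | 0 < t ∧ nakanoModular p (fun n => a n / t) ≤ 1} := rfl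

/-- The set where the modular is at most one; the norm is its gauge. -/
def NakanoSpace.modularBall (p : ℕ → ℝ) (hp : ∀ n, 1 ≤ p n) : Set (NakanoSpace p hp) :=
  {a | nakanoModular p a ≤ 1}

theorem NakanoSpace.norm_eq_gauge (a : NakanoSpace p hp) :
    ‖a‖ = gauge (NakanoSpace.modularBall p hp) a := by
  rw [NakanoSpace.norm_def, gauge_def']
  congr 1
  ext t
  have h : (fun n => a n / t) = ((t⁻¹ • a : NakanoSpace p hp) : ℕ → ℝ) := by
    ext n
    change a n / t = t⁻¹ * a n
    rw [div_eq_inv_mul]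
  simp only [Set.mem_ofPred_eq, Set.mem_Ioi, NakanoSpace.modularBall, h]

theorem NakanoSpace.convex_modularBall : Convex ℝ (NakanoSpace.modularBall p hp) := by
  intro a ha b hb s t hs ht hst
  refine (nakanoModular_convex hp a b hs ht hst).trans ?_
  calc ENNReal.ofReal s * nakanoModular p a + ENNReal.ofReal t * nakanoModular p b
      ≤ ENNReal.ofReal s * 1 + ENNReal.ofReal t * 1 := by
        gcongr
        · exact ha
        · exact hb
    _ = 1 := by rw [mul_one, mul_one, ← ENNReal.ofReal_add hs ht, hst, ENNReal.ofReal_one]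

theorem NakanoSpace.exists_modular_le_one (a : NakanoSpace p hp) :
    ∃ t : ℝ, 0 < t ∧ nakanoModular p (fun n => a n / t) ≤ 1 := by
  obtain ⟨t, ht, h⟩ := a.2
  set M := (nakanoModular p (fun n => a n / t)).toReal with hM
  have hM0 : 0 ≤ M := ENNReal.toReal_nonneg
  refine ⟨t * (M + 1), by positivity, ?_⟩
  have key : (fun n => a n / (t * (M + 1))) = (M + 1)⁻¹ • (fun n => a n / t) := by
    ext n
    simp only [Pi.smul_apply, smul_eq_mul]
    field_simp
  rw [key]
  refine (nakanoModular_smul_le hp _ (by positivity) (inv_le_one_of_one_le₀ (by linarith))).trans ?_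
  have h' : nakanoModular p (fun n => a n / t) = ENNReal.ofReal M := (ENNReal.ofReal_toReal h.ne).symm
  rw [h', ← ENNReal.ofReal_mul (by positivity), ← ENNReal.ofReal_one]
  refine ENNReal.ofReal_le_ofReal ?_
  rw [inv_mul_le_one₀ (by positivity)]
  linarith

theorem NakanoSpace.absorbent_modularBall : Absorbent ℝ (NakanoSpace.modularBall p hp) := by
  intro a
  obtain ⟨t, ht, h⟩ := a.exists_modular_le_one
  refine absorbs_iff_norm.2 ⟨t, fun c hc => ?_⟩
  have hc0 : c ≠ 0 := by
    rintro rfl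
    simp at hc
    linarith
  rw [Set.singleton_subset_iff, Set.mem_smul_set_iff_inv_smul_mem₀ hc0]
  refine (nakanoModular_mono hp fun n => ?_).trans h
  change |c⁻¹ * a n| ≤ |a n / t|
  rw [abs_mul, abs_inv, abs_div, abs_of_pos ht, ← div_eq_inv_mul]
  exact div_le_div_of_nonneg_left (abs_nonneg _) ht hc

theorem NakanoSpace.neg_mem_modularBall :
    ∀ a ∈ NakanoSpace.modularBall p hp, -a ∈ NakanoSpace.modularBall p hp := by
  intro a ha
  exact (nakanoModular_neg p a).le.trans ha

theorem NakanoSpace.abs_apply_le_norm (a : NakanoSpace p hp) (n : ℕ) : |a n| ≤ ‖a‖ := by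
  rw [NakanoSpace.norm_def]
  refine le_csInf a.exists_modular_le_one ?_
  rintro t ⟨ht, h⟩
  have h1 : ENNReal.ofReal (|a n / t| ^ p n) ≤ 1 := (ENNReal.le_tsum n).trans h
  rw [ENNReal.ofReal_le_one] at h1
  have hpn : 0 < p n := zero_lt_one.trans_le (hp n)
  have h2 : |a n / t| ≤ 1 := by
    by_contra! hlt
    exact absurd h1 (not_le.2 (Real.one_lt_rpow hlt hpn))
  rw [abs_div, abs_of_pos ht, div_le_one ht] at h2
  exact h2

theorem NakanoSpace.normedSpaceCore : NormedSpace.Core ℝ (NakanoSpace p hp) where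
  norm_nonneg a := by
    rw [NakanoSpace.norm_eq_gauge]; exact gauge_nonneg a
  norm_smul c a := by
    have h := gauge_smul_of_nonneg (s := NakanoSpace.modularBall p hp) (abs_nonneg c) a
    rw [smul_eq_mul] at h
    rw [NakanoSpace.norm_eq_gauge, NakanoSpace.norm_eq_gauge, Real.norm_eq_abs, ← h]
    rcases abs_choice c with hc | hc
    · rw [hc]
    · rw [hc, neg_smul, gauge_neg NakanoSpace.neg_mem_modularBall]
  norm_triangle a b := by
    simp only [NakanoSpace.norm_eq_gauge]
    exact gauge_add_le NakanoSpace.convex_modularBall NakanoSpace.absorbent_modularBall a b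
  norm_eq_zero_iff a := by
    constructor
    · intro h
      refine Subtype.ext (funext fun n => ?_)
      have := a.abs_apply_le_norm n
      rw [h] at this
      exact abs_nonpos_iff.1 this
    · rintro rfl
      rw [NakanoSpace.norm_eq_gauge, gauge_zero]

noncomputable instance : NormedAddCommGroup (NakanoSpace p hp) :=
  NormedAddCommGroup.ofCore NakanoSpace.normedSpaceCore

noncomputable instance : NormedSpace ℝ (NakanoSpace p hp) :=
  NormedSpace.ofCore NakanoSpace.normedSpaceCore

/-- The `n`-th canonical unit vector of `ℓ_(pₙ)`. -/
def NakanoSpace.unit (p : ℕ → ℝ) (hp : ∀ n, 1 ≤ p n) (n : ℕ) : NakanoSpace p hp :=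
  ⟨Pi.single n 1, 1, one_pos, by
    unfold nakanoModular
    rw [tsum_eq_single n]
    · exact ENNReal.ofReal_lt_top
    · intro m hm
      have : p m ≠ 0 := by linarith [hp m]
      simp [Pi.single_eq_of_ne hm, Real.zero_rpow this]⟩

/-- The (restricted) Nakano space `h_(pₙ)`: the closed linear span of the unit vectors in
`ℓ_(pₙ)`. -/
noncomputable def restrictedNakanoSpace (p : ℕ → ℝ) (hp : ∀ n, 1 ≤ p n) : Submodule ℝ (NakanoSpace p hp) :=
  (Submodule.span ℝ (Set.range (NakanoSpace.unit p hp))).topologicalClosure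

end NakanoSpaces

/-! ### Greedy bases and equivalence of sequences -/

section GreedyBases

/-- The norms of the members of `x` are bounded above, and bounded below away from zero. -/
def IsSeminormalized {X : Type*} [NormedAddCommGroup X] (x : ℕ → X) : Prop :=
  ∃ c C : ℝ, 0 < c ∧ ∀ n, c ≤ ‖x n‖ ∧ ‖x n‖ ≤ C

/-- `Λ` is a greedy set of `v`: every coefficient of `v` with index in `Λ` is at least as large,
in absolute value, as every coefficient with index outside `Λ`. -/
def IsGreedySet {X : Type*} [NormedAddCommGroup X] [NormedSpace ℝ X]
    (b : SchauderBasis ℝ X) (v : X) (Λ : Finset ℕ) : Prop :=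
  ∀ n ∈ Λ, ∀ m ∉ Λ, |b.coord m v| ≤ |b.coord n v|

/-- A seminormalized Schauder basis is greedy if, for some constant `C`, every greedy
approximation of a vector `v` with `N` terms is, up to the factor `C`, at least as good as every
linear combination of `N` members of the basis. -/
def IsGreedyBasis {X : Type*} [NormedAddCommGroup X] [NormedSpace ℝ X]
    (b : SchauderBasis ℝ X) : Prop :=
  IsSeminormalized b ∧
    ∃ C : ℝ, ∀ (v : X) (N : ℕ) (Λ : Finset ℕ), Λ.card = N → IsGreedySet b v Λ →
      ∀ (A : Finset ℕ) (α : ℕ → ℝ), A.card = N →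
        ‖v - ∑ n ∈ Λ, b.coord n v • b n‖ ≤ C * ‖v - ∑ n ∈ A, α n • b n‖

/-- The space `X` has a greedy basis (indexed by `ℕ`). -/
def HasGreedyBasis (X : Type*) [NormedAddCommGroup X] [NormedSpace ℝ X] : Prop :=
  ∃ b : SchauderBasis ℝ X, IsGreedyBasis b

/-- The sequence `x` is a greedy basis of its closed linear span. -/
def IsGreedyBasicSequence {X : Type*} [NormedAddCommGroup X] [NormedSpace ℝ X]
    (x : ℕ → X) : Prop :=
  ∃ b : SchauderBasis ℝ (Submodule.span ℝ (Set.range x)).topologicalClosure,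
    (∀ n, (b n : X) = x n) ∧ IsGreedyBasis b

/-- Equivalence of two sequences, in possibly different spaces. -/
def AreEquivalentSequences {X Y : Type*} [NormedAddCommGroup X] [NormedSpace ℝ X]
    [NormedAddCommGroup Y] [NormedSpace ℝ Y] (x : ℕ → X) (y : ℕ → Y) : Prop :=
  ∃ C : ℝ, 1 ≤ C ∧ ∀ (N : ℕ) (a : ℕ → ℝ),
    C⁻¹ * ‖∑ n ∈ Finset.range N, a n • x n‖ ≤ ‖∑ n ∈ Finset.range N, a n • y n‖ ∧
      ‖∑ n ∈ Finset.range N, a n • y n‖ ≤ C * ‖∑ n ∈ Finset.range N, a n • x n‖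

/-- The `n`-th unit vector of `c₀`, where `c₀` is the space `C₀(ℕ, ℝ)` of real sequences that
tend to zero, with the supremum norm. -/
noncomputable def c0Unit (n : ℕ) : C₀(ℕ, ℝ) where
  toFun := Pi.single n 1
  continuous_toFun := continuous_of_discreteTopology
  zero_at_infty' := by
    rw [cocompact_eq_cofinite]
    refine tendsto_nhds_of_eventually_eq ?_
    filter_upwards [(Set.finite_singleton n).compl_mem_cofinite] with m hm
    exact Pi.single_eq_of_ne hm 1

end GreedyBases

/-!
All three parts rest on the fact that a greedy basis `b` of a subspace of `h_(pₙ)` is equivalent to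
the unit vector basis of `c₀` when `pₙ → ∞`.

A greedy basis is unconditional (`IsGreedyBasis.exists_norm_sub_le`) and democratic
(`IsGreedyBasis.exists_norm_sum_le_of_disjoint`), so the equivalence follows once there are, for
every `N`, sets `A` of size `N` for which `‖∑ n ∈ A, b n‖` stays bounded
(`IsGreedyBasis.areEquivalentSequences_c0Unit`). The space `h_(pₙ)` provides such sets: adding
bounded vectors that tend to zero coordinatewise does not, in the limit, increase the norm beyond the
maximum of the norms (`NakanoSpace.eventually_norm_add_le`), because a vector supported where the
exponents are large has a tiny modular at any scale above its norm. This is applied to differences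
of terms of a coordinatewise convergent subsequence of `b`, and unconditionality removes one half of
each difference (`IsGreedyBasis.exists_card_eq_norm_sum_le`). In a complete space a basis equivalent
to that of `c₀` gives an isomorphism onto `c₀`; conversely the unit vectors of `c₀` are greedy, and
isomorphisms carry greedy bases to greedy bases.

For the whole space it remains to see that an isomorphism `T : h_(pₙ) → c₀` forces
`∑ n ∈ A, e n` to be bounded over all finite `A` (`NakanoSpace.exists_norm_sum_unit_le`). Let `v n`
be `T (e n)` with all coordinates of absolute value at most a small `δ` replaced by zero. For a fixed
coordinate `j`, only a bounded number of indices `n` far out have `|T (e n) j| > δ`, since many such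
`n` would contradict the boundedness of `T` on signed sums of a bounded number of unit vectors far out,
whose norm is at most `2`. Hence all signed sums `∑ ± v n` are bounded in `c₀`, and so are those of
`T⁻¹ (v n)` in `h_(pₙ)`. Averaging over signs, coordinate by coordinate, bounds the diagonal
`∑ (T⁻¹ (v n))_n e n` (`NakanoSpace.norm_sum_diag_le`), whose coefficients are at least `1 / 2`. Once
the sums of unit vectors are bounded, a constant sequence has finite modular and `h_(pₙ) = c₀`; the
norms are then equivalent by the open mapping theorem.
-/

/-! ### The unit vector basis of `c₀` -/

section CZero

theorem c0_abs_apply_le_norm (f : C₀(ℕ, ℝ)) (n : ℕ) : |f n| ≤ ‖f‖ := by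
  rw [← ZeroAtInftyContinuousMap.norm_toBCF_eq_norm]
  exact f.toBCF.norm_coe_le_norm n

theorem c0_norm_le {f : C₀(ℕ, ℝ)} {C : ℝ} (hC : 0 ≤ C) : ‖f‖ ≤ C ↔ ∀ n, |f n| ≤ C := by
  rw [← ZeroAtInftyContinuousMap.norm_toBCF_eq_norm]
  exact BoundedContinuousFunction.norm_le hC

theorem c0_tendsto (f : C₀(ℕ, ℝ)) : Tendsto f atTop (𝓝 0) := by
  have h := f.zero_at_infty'
  rw [cocompact_eq_cofinite, Nat.cofinite_eq_atTop] at h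
  exact h

/-- A real sequence tending to zero, as an element of `c₀`. -/
def c0Mk (f : ℕ → ℝ) (hf : Tendsto f atTop (𝓝 0)) : C₀(ℕ, ℝ) where
  toFun := f
  continuous_toFun := continuous_of_discreteTopology
  zero_at_infty' := by rwa [cocompact_eq_cofinite, Nat.cofinite_eq_atTop]

@[simp] theorem c0Mk_apply (f : ℕ → ℝ) (hf : Tendsto f atTop (𝓝 0)) (n : ℕ) :
    c0Mk f hf n = f n := rfl

theorem c0Unit_apply (n m : ℕ) : c0Unit n m = if m = n then 1 else 0 :=
  Pi.single_apply n 1 m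

/-- The `n`-th coordinate functional of `c₀`. -/
noncomputable def c0Coord (n : ℕ) : StrongDual ℝ C₀(ℕ, ℝ) :=
  LinearMap.mkContinuous
    { toFun := fun f => f n
      map_add' := fun _ _ => rfl
      map_smul' := fun _ _ => rfl } 1 fun f => by
        simpa using c0_abs_apply_le_norm f n

@[simp] theorem c0Coord_apply (n : ℕ) (f : C₀(ℕ, ℝ)) : c0Coord n f = f n := rfl

theorem c0_sum_smul_unit_apply (A : Finset ℕ) (a : ℕ → ℝ) (m : ℕ) :
    (∑ n ∈ A, a n • c0Unit n) m = if m ∈ A then a m else 0 := by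
  rw [← c0Coord_apply, map_sum]
  simp [c0Unit_apply]

theorem norm_c0_sum_smul_unit_le {A : Finset ℕ} {a : ℕ → ℝ} {C : ℝ} (hC : 0 ≤ C)
    (h : ∀ n ∈ A, |a n| ≤ C) : ‖∑ n ∈ A, a n • c0Unit n‖ ≤ C := by
  refine (c0_norm_le hC).2 fun m => ?_
  rw [c0_sum_smul_unit_apply]
  split_ifs with hm
  · exact h m hm
  · simpa using hC

theorem c0_tendsto_sum_range (f : C₀(ℕ, ℝ)) :
    Tendsto (fun N => ∑ n ∈ Finset.range N, f n • c0Unit n) atTop (𝓝 f) := by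
  rw [Metric.tendsto_atTop]
  intro ε hε
  obtain ⟨N, hN⟩ := Metric.tendsto_atTop.1 (c0_tendsto f) (ε / 2) (by positivity)
  refine ⟨N, fun k hk => ?_⟩
  rw [dist_eq_norm]
  refine lt_of_le_of_lt ((c0_norm_le (half_pos hε).le).2 fun m => ?_) (half_lt_self hε)
  rw [ZeroAtInftyContinuousMap.sub_apply, c0_sum_smul_unit_apply]
  split_ifs with hm
  · simpa using (half_pos hε).le
  · have := (hN m (hk.trans (by simpa using hm))).le
    simpa using this

/-- A greedy set loses nothing against any other set of the same size in `c₀`: outside of it only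
the smaller coefficients survive, and a different set of the same size must miss one of the larger
ones. -/
theorem c0_norm_sub_greedy_le (f : C₀(ℕ, ℝ)) {Λ A : Finset ℕ} (hcard : A.card = Λ.card)
    (hΛ : ∀ n ∈ Λ, ∀ m ∉ Λ, |f m| ≤ |f n|) (α : ℕ → ℝ) :
    ‖f - ∑ n ∈ Λ, f n • c0Unit n‖ ≤ ‖f - ∑ n ∈ A, α n • c0Unit n‖ := by
  have hout : ∀ m ∉ A, |f m| ≤ ‖f - ∑ n ∈ A, α n • c0Unit n‖ := fun m hm => by
    have := c0_abs_apply_le_norm (f - ∑ n ∈ A, α n • c0Unit n) m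
    rwa [ZeroAtInftyContinuousMap.sub_apply, c0_sum_smul_unit_apply, if_neg hm, sub_zero] at this
  refine (c0_norm_le (norm_nonneg _)).2 fun m => ?_
  rw [ZeroAtInftyContinuousMap.sub_apply, c0_sum_smul_unit_apply]
  split_ifs with hm
  · simp
  rw [sub_zero]
  by_cases hmA : m ∈ A
  · have hsub : ¬ Λ ⊆ A := fun h => hm (Finset.eq_of_subset_of_card_le h hcard.le ▸ hmA)
    obtain ⟨n, hn, hnA⟩ := Finset.not_subset.1 hsub
    exact (hΛ n hn m hm).trans (hout n hnA)
  · exact hout m hmA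

variable {X : Type*} [NormedAddCommGroup X] [NormedSpace ℝ X]

/-- The Schauder basis that an isomorphism onto `c₀` pulls back from the unit vectors. -/
noncomputable def c0PullbackBasis (e : X ≃L[ℝ] C₀(ℕ, ℝ)) : SchauderBasis ℝ X where
  basis n := e.symm (c0Unit n)
  coord n := (c0Coord n).comp (e : X →L[ℝ] C₀(ℕ, ℝ))
  ortho i j := by simp [c0Unit_apply, Pi.single_apply]
  expansion x := by
    rw [HasSum, SummationFilter.conditional_filter_eq_map_range, tendsto_map'_iff]
    have h := (e.symm.continuous.tendsto _).comp (c0_tendsto_sum_range (e x))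
    simpa [Function.comp_def] using h

theorem hasGreedyBasis_of_equiv_c0 (e : X ≃L[ℝ] C₀(ℕ, ℝ)) : HasGreedyBasis X := by
  have hunit : ∀ n, ‖c0Unit n‖ = 1 := fun n => by
    refine le_antisymm ((c0_norm_le zero_le_one).2 fun m => ?_) ?_
    · rw [c0Unit_apply]; split_ifs <;> simp
    · simpa [c0Unit_apply] using c0_abs_apply_le_norm (c0Unit n) n
  set S : C₀(ℕ, ℝ) →L[ℝ] X := (e.symm : C₀(ℕ, ℝ) →L[ℝ] X) with hS
  set T : X →L[ℝ] C₀(ℕ, ℝ) := (e : X →L[ℝ] C₀(ℕ, ℝ)) with hT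
  have hTS : ∀ f, T (S f) = f := e.apply_symm_apply
  have hST : ∀ v, S (T v) = v := e.symm_apply_apply
  refine ⟨c0PullbackBasis e, ⟨(‖T‖ + 1)⁻¹, ‖S‖, by positivity, fun n => ⟨?_, ?_⟩⟩,
    ‖S‖ * ‖T‖, ?_⟩
  · change (‖T‖ + 1)⁻¹ ≤ ‖S (c0Unit n)‖
    rw [inv_le_iff_one_le_mul₀ (by positivity)]
    have h1 := T.le_opNorm (S (c0Unit n))
    rw [hTS, hunit] at h1
    nlinarith [norm_nonneg (S (c0Unit n))]
  · change ‖S (c0Unit n)‖ ≤ ‖S‖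
    simpa [hunit] using S.le_opNorm (c0Unit n)
  · intro v N Λ hΛ hgreedy A α hA
    have hg := c0_norm_sub_greedy_le (T v) (hA.trans hΛ.symm) hgreedy α
    change ‖v - ∑ n ∈ Λ, (T v) n • S (c0Unit n)‖ ≤
      ‖S‖ * ‖T‖ * ‖v - ∑ n ∈ A, α n • S (c0Unit n)‖
    have e1 : v - ∑ n ∈ Λ, (T v) n • S (c0Unit n) =
        S (T v - ∑ n ∈ Λ, (T v) n • c0Unit n) := by
      simp only [map_sub, map_sum, map_smul, hST]
    have e2 : T v - ∑ n ∈ A, α n • c0Unit n = T (v - ∑ n ∈ A, α n • S (c0Unit n)) := by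
      simp only [map_sub, map_sum, map_smul, hTS]
    rw [e1, mul_assoc]
    refine (S.le_opNorm _).trans (mul_le_mul_of_nonneg_left ?_ (norm_nonneg _))
    refine hg.trans ?_
    rw [e2]
    exact T.le_opNorm _

end CZero

/-! ### Greedy bases equivalent to the unit vectors of `c₀` -/

section GreedyToCZero

variable {Z : Type*} [NormedAddCommGroup Z] [NormedSpace ℝ Z] (b : SchauderBasis ℝ Z)

theorem schauder_coord_apply (i j : ℕ) : b.coord i (b j) = if i = j then 1 else 0 := by
  simp [b.ortho, Pi.single_apply]

theorem schauder_coord_sum_smul (A : Finset ℕ) (a : ℕ → ℝ) (m : ℕ) :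
    b.coord m (∑ n ∈ A, a n • b n) = if m ∈ A then a m else 0 := by
  simp [b.ortho, Pi.single_apply]

theorem schauder_tendsto_sum_range (v : Z) :
    Tendsto (fun N => ∑ n ∈ Finset.range N, b.coord n v • b n) atTop (𝓝 v) := by
  simpa using SchauderBasis.tendsto_proj b v

theorem schauder_coord_tendsto_zero {c : ℝ} (hc : 0 < c) (hb : ∀ n, c ≤ ‖b n‖) (v : Z) :
    Tendsto (fun n => b.coord n v) atTop (𝓝 0) := by
  have h := schauder_tendsto_sum_range b v
  have h1 := ((h.comp (tendsto_add_atTop_nat 1)).sub h).norm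
  simp only [Function.comp_def, Finset.sum_range_succ, add_sub_cancel_left, sub_self,
    norm_zero] at h1
  refine squeeze_zero_norm (fun n => ?_) (by simpa using h1.const_mul c⁻¹)
  rw [norm_smul, ← div_eq_inv_mul, le_div_iff₀ hc]
  exact mul_le_mul_of_nonneg_left (hb n) (norm_nonneg _)

variable {b}

/-- Greedy bases are unconditional: adding a large constant on `A` to the coefficients of `v` makes
`A` a greedy set, and its greedy remainder is `v` with the coordinates in `A` removed. -/
theorem IsGreedyBasis.exists_norm_sub_le (hb : IsGreedyBasis b) :
    ∃ C : ℝ, 0 ≤ C ∧ ∀ (v : Z) (A : Finset ℕ), ‖v - ∑ n ∈ A, b.coord n v • b n‖ ≤ C * ‖v‖ := by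
  obtain ⟨⟨c, _, hc, hbn⟩, C, hC⟩ := hb
  refine ⟨|C|, abs_nonneg C, fun v A => ?_⟩
  obtain ⟨t, ht⟩ := (schauder_coord_tendsto_zero b hc (fun n => (hbn n).1) v).abs.bddAbove_range
  have ht' : ∀ m, |b.coord m v| ≤ t := fun m => ht ⟨m, rfl⟩
  have ht0 : 0 ≤ t := (abs_nonneg _).trans (ht' 0)
  set y := v + ∑ n ∈ A, (t - b.coord n v) • b n with hy
  have hcoord : ∀ m, b.coord m y = if m ∈ A then t else b.coord m v := fun m => by
    rw [hy, map_add, schauder_coord_sum_smul]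
    split_ifs <;> ring
  have hgr : IsGreedySet b y A := fun n hn m hm => by
    rw [hcoord, hcoord, if_pos hn, if_neg hm, abs_of_nonneg ht0]
    exact ht' m
  have h := hC y A.card A rfl hgr A (fun n => t - b.coord n v) rfl
  have e1 : y - ∑ n ∈ A, b.coord n y • b n = v - ∑ n ∈ A, b.coord n v • b n := by
    have : ∑ n ∈ A, b.coord n y • b n = ∑ n ∈ A, t • b n :=
      Finset.sum_congr rfl fun n hn => by rw [hcoord, if_pos hn]
    rw [this, hy]
    simp only [sub_smul, Finset.sum_sub_distrib]
    abel
  rw [e1, hy, add_sub_cancel_right] at h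
  exact h.trans (mul_le_mul_of_nonneg_right (le_abs_self C) (norm_nonneg _))

theorem IsGreedyBasis.exists_norm_sum_le (hb : IsGreedyBasis b) :
    ∃ C : ℝ, 0 ≤ C ∧ ∀ (v : Z) (A : Finset ℕ), ‖∑ n ∈ A, b.coord n v • b n‖ ≤ C * ‖v‖ := by
  obtain ⟨C, hC0, hC⟩ := hb.exists_norm_sub_le
  refine ⟨C + 1, by positivity, fun v A => ?_⟩
  have := norm_sub_norm_le (∑ n ∈ A, b.coord n v • b n) v
  rw [norm_sub_rev] at this
  linarith [hC v A]

/-- Greedy bases are democratic: of two disjoint sets of the same size, either one is a greedy set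
of the sum of all basis vectors with index in their union. -/
theorem IsGreedyBasis.exists_norm_sum_le_of_disjoint (hb : IsGreedyBasis b) :
    ∃ C : ℝ, 0 ≤ C ∧ ∀ A B : Finset ℕ, Disjoint A B → A.card = B.card →
      ‖∑ n ∈ B, b n‖ ≤ C * ‖∑ n ∈ A, b n‖ := by
  obtain ⟨-, C, hC⟩ := hb
  refine ⟨|C|, abs_nonneg C, fun A B hAB hcard => ?_⟩
  set y := ∑ n ∈ A ∪ B, (1 : ℝ) • b n with hy
  have hyAB : y = ∑ n ∈ A, b n + ∑ n ∈ B, b n := by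
    rw [hy, Finset.sum_union hAB]; simp
  have hcoord : ∀ m, b.coord m y = if m ∈ A ∪ B then 1 else 0 := fun m =>
    schauder_coord_sum_smul b (A ∪ B) (fun _ => 1) m
  have hgr : IsGreedySet b y A := fun n hn m hm => by
    rw [hcoord, hcoord, if_pos (Finset.mem_union_left _ hn)]
    split_ifs <;> simp
  have h := hC y A.card A rfl hgr B (fun _ => 1) hcard.symm
  have e1 : ∑ n ∈ A, b.coord n y • b n = ∑ n ∈ A, b n :=
    Finset.sum_congr rfl fun n hn => by
      rw [hcoord, if_pos (Finset.mem_union_left _ hn), one_smul]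
  rw [e1, hyAB] at h
  simp only [one_smul, add_sub_cancel_left, add_sub_cancel_right] at h
  exact h.trans (mul_le_mul_of_nonneg_right (le_abs_self C) (norm_nonneg _))

/-- If all finite subsums of `x` are bounded by `K`, then coefficients of size at most `M` produce
vectors of norm at most `2 K M`. Seen through a functional `g` of norm one, the sum is at most
`M ∑ |g (x n)|`, and the sign of `g (x n)` splits that sum into two subsums of `x`. -/
theorem norm_sum_smul_le_of_norm_sum_le {x : ℕ → Z} {K : ℝ}
    (hK : ∀ A : Finset ℕ, ‖∑ n ∈ A, x n‖ ≤ K) {A : Finset ℕ} {a : ℕ → ℝ} {M : ℝ}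
    (ha : ∀ n ∈ A, |a n| ≤ M) (hM : 0 ≤ M) : ‖∑ n ∈ A, a n • x n‖ ≤ 2 * K * M := by
  have hK0 : 0 ≤ K := (norm_nonneg _).trans (hK ∅)
  refine NormedSpace.norm_le_dual_bound ℝ _ (by positivity) fun g => ?_
  have hsub : ∀ B : Finset ℕ, |∑ n ∈ B, g (x n)| ≤ ‖g‖ * K := fun B => by
    rw [← map_sum]
    exact (g.le_opNorm _).trans (mul_le_mul_of_nonneg_left (hK B) (norm_nonneg _))
  have habs : ∑ n ∈ A, |g (x n)| ≤ 2 * (‖g‖ * K) := by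
    rw [← Finset.sum_filter_add_sum_filter_not A (fun n => 0 ≤ g (x n))]
    have h1 : ∑ n ∈ A with 0 ≤ g (x n), |g (x n)| = ∑ n ∈ A with 0 ≤ g (x n), g (x n) :=
      Finset.sum_congr rfl fun n hn => abs_of_nonneg (Finset.mem_filter.1 hn).2
    have h2 : ∑ n ∈ A with ¬ 0 ≤ g (x n), |g (x n)| = -∑ n ∈ A with ¬ 0 ≤ g (x n), g (x n) := by
      rw [← Finset.sum_neg_distrib]
      exact Finset.sum_congr rfl fun n hn => abs_of_neg (not_le.1 (Finset.mem_filter.1 hn).2)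
    rw [h1, h2]
    linarith [le_abs_self (∑ n ∈ A with 0 ≤ g (x n), g (x n)),
      neg_abs_le (∑ n ∈ A with ¬ 0 ≤ g (x n), g (x n)),
      hsub (A.filter fun n => 0 ≤ g (x n)), hsub (A.filter fun n => ¬ 0 ≤ g (x n))]
  rw [map_sum, Real.norm_eq_abs]
  calc |∑ n ∈ A, g (a n • x n)| ≤ ∑ n ∈ A, |g (a n • x n)| := Finset.abs_sum_le_sum_abs _ _
    _ ≤ ∑ n ∈ A, M * |g (x n)| := Finset.sum_le_sum fun n hn => by
        rw [map_smul, smul_eq_mul, abs_mul]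
        exact mul_le_mul_of_nonneg_right (ha n hn) (abs_nonneg _)
    _ = M * ∑ n ∈ A, |g (x n)| := by rw [Finset.mul_sum]
    _ ≤ M * (2 * (‖g‖ * K)) := mul_le_mul_of_nonneg_left habs hM
    _ = 2 * K * M * ‖g‖ := by ring

/-- A greedy basis with arbitrarily long bounded sums `∑ n ∈ A, b n` has all such sums bounded. -/
theorem IsGreedyBasis.exists_norm_sum_le_of_frequently (hb : IsGreedyBasis b) {K : ℝ}
    (hK : ∀ N : ℕ, ∃ A : Finset ℕ, A.card = N ∧ ‖∑ n ∈ A, b n‖ ≤ K) :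
    ∃ K' : ℝ, ∀ B : Finset ℕ, ‖∑ n ∈ B, b n‖ ≤ K' := by
  obtain ⟨C, hC0, hC⟩ := hb.exists_norm_sum_le
  obtain ⟨D, hD0, hD⟩ := hb.exists_norm_sum_le_of_disjoint
  refine ⟨D * (C * K), fun B => ?_⟩
  obtain ⟨A, hA, hAK⟩ := hK (B.card + B.card)
  obtain ⟨A', hA', hcard⟩ := Finset.exists_subset_card_eq
    (show B.card ≤ (A \ B).card by have := Finset.le_card_sdiff B A; omega)
  refine (hD A' B (Finset.disjoint_of_subset_left hA' Finset.sdiff_disjoint) hcard).trans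
    (mul_le_mul_of_nonneg_left ?_ hD0)
  have e : ∑ n ∈ A', b.coord n (∑ m ∈ A, b m) • b n = ∑ n ∈ A', b n :=
    Finset.sum_congr rfl fun n hn => by
      have h := schauder_coord_sum_smul b A (fun _ => 1) n
      simp only [one_smul] at h
      rw [h, if_pos (Finset.mem_sdiff.1 (hA' hn)).1, one_smul]
  rw [← e]
  exact (hC _ A').trans (mul_le_mul_of_nonneg_left hAK hC0)

theorem IsGreedyBasis.areEquivalentSequences_c0Unit (hb : IsGreedyBasis b) {K : ℝ}
    (hK : ∀ N : ℕ, ∃ A : Finset ℕ, A.card = N ∧ ‖∑ n ∈ A, b n‖ ≤ K) :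
    AreEquivalentSequences b c0Unit := by
  obtain ⟨K', hK'⟩ := hb.exists_norm_sum_le_of_frequently hK
  obtain ⟨C, hC0, hC⟩ := hb.exists_norm_sum_le
  obtain ⟨⟨c, _, hc, hbn⟩, -⟩ := hb
  set E := max 1 (max (2 * K') (c⁻¹ * C)) with hE
  have hE1 : 1 ≤ E := le_max_left _ _
  have hE2 : 2 * K' ≤ E := (le_max_left _ _).trans (le_max_right _ _)
  have hE3 : c⁻¹ * C ≤ E := (le_max_right _ _).trans (le_max_right _ _)
  refine ⟨E, hE1, fun N a => ⟨?_, ?_⟩⟩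
  · rw [inv_mul_le_iff₀ (by positivity)]
    refine (norm_sum_smul_le_of_norm_sum_le hK' (M := ‖∑ n ∈ Finset.range N, a n • c0Unit n‖)
      (fun n hn => ?_) (norm_nonneg _)).trans (mul_le_mul_of_nonneg_right hE2 (norm_nonneg _))
    have := c0_abs_apply_le_norm (∑ n ∈ Finset.range N, a n • c0Unit n) n
    rwa [c0_sum_smul_unit_apply, if_pos hn] at this
  · refine norm_c0_sum_smul_unit_le (by positivity) fun n hn => ?_
    have h := hC (∑ n ∈ Finset.range N, a n • b n) {n}
    rw [Finset.sum_singleton, schauder_coord_sum_smul, if_pos hn, norm_smul, Real.norm_eq_abs] at h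
    calc |a n| ≤ c⁻¹ * (|a n| * ‖b n‖) := by
          rw [← div_eq_inv_mul, le_div_iff₀ hc]
          exact mul_le_mul_of_nonneg_left (hbn n).1 (abs_nonneg _)
      _ ≤ c⁻¹ * (C * ‖∑ n ∈ Finset.range N, a n • b n‖) := by gcongr
      _ = c⁻¹ * C * ‖∑ n ∈ Finset.range N, a n • b n‖ := by ring
      _ ≤ E * ‖∑ n ∈ Finset.range N, a n • b n‖ := by gcongr

/-- The coordinate map of a basis equivalent to the unit vectors of `c₀` is an isomorphism onto
`c₀`: it is bounded below, so its range is closed, and the range contains the unit vectors. -/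
theorem nonempty_equiv_c0_of_areEquivalentSequences [CompleteSpace Z]
    (h : AreEquivalentSequences b c0Unit) : Nonempty (Z ≃L[ℝ] C₀(ℕ, ℝ)) := by
  obtain ⟨C, hC1, hC⟩ := h
  have hC0 : 0 < C := zero_lt_one.trans_le hC1
  have hle : ∀ v n, |b.coord n v| ≤ C * ‖v‖ := fun v n => by
    refine ge_of_tendsto ((schauder_tendsto_sum_range b v).norm.const_mul C) ?_
    filter_upwards [eventually_gt_atTop n] with N hN
    refine le_trans ?_ (hC N _).2
    have := c0_abs_apply_le_norm (∑ n ∈ Finset.range N, b.coord n v • c0Unit n) n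
    rwa [c0_sum_smul_unit_apply, if_pos (Finset.mem_range.2 hN)] at this
  have hlow : ∀ n, C⁻¹ ≤ ‖b n‖ := fun n => by
    have := hle (b n) n
    rw [schauder_coord_apply, if_pos rfl, abs_one] at this
    rwa [inv_le_iff_one_le_mul₀ hC0, mul_comm]
  have hzero := schauder_coord_tendsto_zero b (inv_pos.2 hC0) hlow
  let J : Z →L[ℝ] C₀(ℕ, ℝ) := LinearMap.mkContinuous
    { toFun := fun v => c0Mk (fun n => b.coord n v) (hzero v)
      map_add' := fun u v => by ext n; simp
      map_smul' := fun r v => by ext n; simp } C fun v =>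
        (c0_norm_le (by positivity)).2 fun n => hle v n
  have hJ : ∀ v n, J v n = b.coord n v := fun _ _ => rfl
  have hbelow : ∀ v, ‖v‖ ≤ C * ‖J v‖ := fun v => by
    refine le_of_tendsto (schauder_tendsto_sum_range b v).norm (.of_forall fun N => ?_)
    have := (hC N fun n => b.coord n v).1
    rw [inv_mul_le_iff₀ hC0] at this
    refine this.trans (mul_le_mul_of_nonneg_left ?_ hC0.le)
    exact norm_c0_sum_smul_unit_le (norm_nonneg _) fun n _ => c0_abs_apply_le_norm (J v) n
  have hanti : AntilipschitzWith C.toNNReal J :=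
    J.antilipschitz_of_bound fun v => by rw [Real.coe_toNNReal _ hC0.le]; exact hbelow v
  have hclosed : IsClosed (Set.range J) := hanti.isClosed_range J.uniformContinuous
  have hJb : ∀ n, J (b n) = c0Unit n := fun n => by
    ext m
    rw [hJ, schauder_coord_apply, c0Unit_apply]
  have hsurj : Function.Surjective J := fun f => by
    have : f ∈ Set.range J := hclosed.mem_of_tendsto (c0_tendsto_sum_range f)
      (.of_forall fun N => ⟨∑ n ∈ Finset.range N, f n • b n, by
        simp only [map_sum, map_smul, hJb]⟩)
    exact this
  exact ⟨ContinuousLinearEquiv.ofBijective J (LinearMap.ker_eq_bot.2 hanti.injective)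
    (LinearMap.range_eq_top.2 hsurj)⟩

end GreedyToCZero

/-! ### The norm of the Nakano space and its completeness -/

section NakanoNorm

namespace NakanoSpace

variable {p : ℕ → ℝ} {hp : ∀ n, 1 ≤ p n}

@[simp] theorem add_apply (a b : NakanoSpace p hp) (n : ℕ) : (a + b) n = a n + b n := rfl

@[simp] theorem sub_apply (a b : NakanoSpace p hp) (n : ℕ) : (a - b) n = a n - b n := rfl

@[simp] theorem smul_apply (c : ℝ) (a : NakanoSpace p hp) (n : ℕ) : (c • a) n = c * a n := rfl

@[simp] theorem zero_apply (n : ℕ) : (0 : NakanoSpace p hp) n = 0 := rfl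

theorem unit_apply (n m : ℕ) : unit p hp n m = if m = n then 1 else 0 := Pi.single_apply n 1 m

variable (p hp) in
/-- The `n`-th coordinate of `ℓ_(pₙ)` as a continuous functional. -/
noncomputable def coordCLM (n : ℕ) : NakanoSpace p hp →L[ℝ] ℝ :=
  LinearMap.mkContinuous
    { toFun := fun a => a n
      map_add' := fun _ _ => rfl
      map_smul' := fun _ _ => rfl } 1 fun a => by
        rw [one_mul]
        exact abs_apply_le_norm a n

@[simp] theorem coordCLM_apply (n : ℕ) (a : NakanoSpace p hp) : coordCLM p hp n a = a n := rfl

theorem sum_apply {ι : Type*} (A : Finset ι) (x : ι → NakanoSpace p hp) (m : ℕ) :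
    (∑ n ∈ A, x n) m = ∑ n ∈ A, x n m := by
  simp only [← coordCLM_apply, map_sum]

theorem sum_smul_unit_apply (A : Finset ℕ) (a : ℕ → ℝ) (m : ℕ) :
    (∑ n ∈ A, a n • unit p hp n) m = if m ∈ A then a m else 0 := by
  simp [sum_apply, unit_apply]

@[ext] theorem ext {a b : NakanoSpace p hp} (h : ∀ n, a n = b n) : a = b :=
  Subtype.ext (funext h)

theorem norm_le_of_modular_le {a : NakanoSpace p hp} {t : ℝ} (ht : 0 < t)
    (h : nakanoModular p (fun n => a n / t) ≤ 1) : ‖a‖ ≤ t :=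
  csInf_le ⟨0, fun _ hs => hs.1.le⟩ ⟨ht, h⟩

theorem modular_le_one_of_norm_lt {a : NakanoSpace p hp} {t : ℝ} (h : ‖a‖ < t) :
    nakanoModular p (fun n => a n / t) ≤ 1 := by
  obtain ⟨s, ⟨hs, hs1⟩, hst⟩ := exists_lt_of_csInf_lt a.exists_modular_le_one h
  refine (nakanoModular_mono hp fun n => ?_).trans hs1
  rw [abs_div, abs_div, abs_of_pos hs, abs_of_pos (hs.trans hst)]
  exact div_le_div_of_nonneg_left (abs_nonneg _) hs hst.le

theorem norm_mono {a b : NakanoSpace p hp} (h : ∀ n, |a n| ≤ |b n|) : ‖a‖ ≤ ‖b‖ := by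
  refine le_of_forall_gt_imp_ge_of_dense fun t ht => ?_
  have ht0 : 0 < t := (norm_nonneg b).trans_lt ht
  refine norm_le_of_modular_le ht0 ((nakanoModular_mono hp fun n => ?_).trans
    (modular_le_one_of_norm_lt ht))
  rw [abs_div, abs_div]
  exact div_le_div_of_nonneg_right (h n) (abs_nonneg t)

/-- Lower semicontinuity of the modular under pointwise convergence. -/
theorem _root_.nakanoModular_le_of_tendsto {ι : Type*} {l : Filter ι} [l.NeBot]
    (hp : ∀ n, 1 ≤ p n) {u : ι → ℕ → ℝ} {a : ℕ → ℝ} {r : ℝ≥0∞}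
    (hu : ∀ n, Tendsto (fun i => u i n) l (𝓝 (a n)))
    (h : ∀ᶠ i in l, nakanoModular p (u i) ≤ r) : nakanoModular p a ≤ r := by
  unfold nakanoModular
  rw [ENNReal.tsum_eq_iSup_sum]
  refine iSup_le fun s => ?_
  have hlim : Tendsto (fun i => ∑ n ∈ s, ENNReal.ofReal (|u i n| ^ p n)) l
      (𝓝 (∑ n ∈ s, ENNReal.ofReal (|a n| ^ p n))) :=
    tendsto_finsetSum _ fun n _ => (ENNReal.continuous_ofReal.tendsto _).comp
      ((hu n).abs.rpow_const (.inr (zero_le_one.trans (hp n))))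
  exact le_of_tendsto hlim (h.mono fun i hi => (ENNReal.sum_le_tsum s).trans hi)

/-- The coordinatewise limit of a Cauchy sequence is its norm limit, because the unit ball of the
modular is closed under pointwise convergence. -/
instance instCompleteSpace : CompleteSpace (NakanoSpace p hp) := by
  refine Metric.complete_of_cauchySeq_tendsto fun u hu => ?_
  have hcoord : ∀ n, ∃ c, Tendsto (fun i => u i n) atTop (𝓝 c) := fun n =>
    cauchySeq_tendsto_of_complete ((coordCLM p hp n).uniformContinuous.comp_cauchySeq hu)
  choose a ha using hcoord
  have key : ∀ ε > 0, ∃ N, ∀ i ≥ N, nakanoModular p (fun n => (u i n - a n) / ε) ≤ 1 := by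
    intro ε hε
    obtain ⟨N, hN⟩ := Metric.cauchySeq_iff.1 hu ε hε
    refine ⟨N, fun i hi => nakanoModular_le_of_tendsto (l := atTop) hp
      (u := fun j n => (u i n - u j n) / ε) (fun n => ((ha n).const_sub _).div_const _) ?_⟩
    filter_upwards [eventually_ge_atTop N] with j hj
    exact modular_le_one_of_norm_lt (a := u i - u j) (by
      rw [← dist_eq_norm]; exact hN i hi j hj)
  obtain ⟨N, hN⟩ := key 1 one_pos
  let d : NakanoSpace p hp :=
    ⟨fun n => u N n - a n, 1, one_pos, (hN N le_rfl).trans_lt ENNReal.one_lt_top⟩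
  refine ⟨u N - d, Metric.tendsto_atTop.2 fun ε hε => ?_⟩
  obtain ⟨N', hN'⟩ := key (ε / 2) (half_pos hε)
  refine ⟨N', fun i hi => lt_of_le_of_lt ?_ (half_lt_self hε)⟩
  rw [dist_eq_norm]
  refine norm_le_of_modular_le (half_pos hε) (le_of_eq_of_le ?_ (hN' i hi))
  congr 1
  ext n
  change (u i n - (u N n - (u N n - a n))) / (ε / 2) = _
  rw [sub_sub_cancel]

end NakanoSpace

end NakanoNorm

/-! ### Greedy bases in `h_(pₙ)` -/

section GreedyInNakano

variable {p : ℕ → ℝ} {hp : ∀ n, 1 ≤ p n}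

namespace NakanoSpace

theorem exists_forall_ge_eq_zero_of_mem_span {w : NakanoSpace p hp}
    (hw : w ∈ Submodule.span ℝ (Set.range (unit p hp))) : ∃ m, ∀ n ≥ m, w n = 0 := by
  induction hw using Submodule.span_induction with
  | mem x hx =>
    obtain ⟨k, rfl⟩ := hx
    exact ⟨k + 1, fun n hn => by rw [unit_apply, if_neg (by omega)]⟩
  | zero => exact ⟨0, fun n _ => rfl⟩
  | add x y _ _ hx hy =>
    obtain ⟨k, hk⟩ := hx
    obtain ⟨l, hl⟩ := hy
    exact ⟨max k l, fun n hn => by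
      rw [add_apply, hk n (le_of_max_le_left hn), hl n (le_of_max_le_right hn), add_zero]⟩
  | smul c x _ hx =>
    obtain ⟨k, hk⟩ := hx
    exact ⟨k, fun n hn => by rw [smul_apply, hk n hn, mul_zero]⟩

theorem eventually_norm_add_le_of_finite_support (hlim : Tendsto p atTop atTop)
    {w : NakanoSpace p hp} {m : ℕ} (hw : ∀ n ≥ m, w n = 0) {ι : Type*} {l : Filter ι}
    {y : ι → NakanoSpace p hp} (hy : ∀ n, Tendsto (fun i => y i n) l (𝓝 0)) {M t : ℝ}
    (hM : ∀ i, ‖y i‖ ≤ M) (hwt : ‖w‖ < t) (hMt : M < t) : ∀ᶠ i in l, ‖w + y i‖ ≤ t := by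
  obtain ⟨s, hs, hst⟩ := exists_between (max_lt hwt hMt)
  have hws : ‖w‖ < s := (le_max_left _ _).trans_lt hs
  have hMs : M < s := (le_max_right _ _).trans_lt hs
  have hs0 : 0 < s := (norm_nonneg w).trans_lt hws
  have ht0 : 0 < t := hs0.trans hst
  set θ := s / t with hθ
  have hθ0 : 0 < θ := by positivity
  have hθ1 : θ < 1 := (div_lt_one ht0).2 hst
  set η := (1 - θ) / 2 with hη
  have hη0 : 0 < η := by rw [hη]; linarith
  have hdiv : ∀ r : ℝ, r / t = θ * (r / s) := fun r => by rw [hθ]; field_simp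
  have hmodw : nakanoModular p (fun n => w n / t) ≤ ENNReal.ofReal θ := by
    have h := nakanoModular_smul_le hp (fun n => w n / s) hθ0.le hθ1.le
    have e : (fun n => w n / t) = θ • fun n => w n / s := by ext n; exact hdiv _
    rw [e]
    exact h.trans (mul_le_of_le_one_right' (modular_le_one_of_norm_lt hws))
  have hpow : ∀ᶠ n in atTop, θ ^ p n ≤ η :=
    ((tendsto_rpow_atTop_of_base_lt_one θ (by linarith) hθ1).comp hlim).eventually_le_const hη0
  obtain ⟨k, hk⟩ := eventually_atTop.1 (hpow.and (eventually_ge_atTop m))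
  -- the coordinates below `k` converge to those of `w`
  have hhead : ∀ᶠ i in l, ∑ n ∈ Finset.range k, ENNReal.ofReal (|(w + y i) n / t| ^ p n) ≤
      ENNReal.ofReal (θ + η) := by
    have hlim' : Tendsto (fun i => ∑ n ∈ Finset.range k, ENNReal.ofReal (|(w + y i) n / t| ^ p n))
        l (𝓝 (∑ n ∈ Finset.range k, ENNReal.ofReal (|w n / t| ^ p n))) := by
      refine tendsto_finsetSum _ fun n _ => (ENNReal.continuous_ofReal.tendsto _).comp
        (Tendsto.rpow_const (Tendsto.abs (Tendsto.div_const ?_ t))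
          (.inr (zero_le_one.trans (hp n))))
      simpa using (hy n).const_add (w n)
    refine hlim'.eventually_le_const (lt_of_le_of_lt ?_ ((ENNReal.ofReal_lt_ofReal_iff
      (by positivity)).2 (lt_add_of_pos_right θ hη0)))
    exact (ENNReal.sum_le_tsum _).trans hmodw
  -- beyond `k`, dividing by `t` instead of `s` multiplies each term by at most `η`
  have htail : ∀ i, ∑' n, ENNReal.ofReal (|(w + y i) (n + k) / t| ^ p (n + k)) ≤
      ENNReal.ofReal η := fun i => by
    calc ∑' n, ENNReal.ofReal (|(w + y i) (n + k) / t| ^ p (n + k))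
        ≤ ∑' n, ENNReal.ofReal η * ENNReal.ofReal (|y i (n + k) / s| ^ p (n + k)) := by
          refine ENNReal.tsum_le_tsum fun n => ?_
          have hn := hk (n + k) (Nat.le_add_left k n)
          rw [← ENNReal.ofReal_mul hη0.le]
          refine ENNReal.ofReal_le_ofReal ?_
          rw [add_apply, hw _ hn.2, zero_add, hdiv, abs_mul, abs_of_pos hθ0,
            Real.mul_rpow hθ0.le (abs_nonneg _)]
          exact mul_le_mul_of_nonneg_right hn.1 (by positivity)
      _ = ENNReal.ofReal η * ∑' n, ENNReal.ofReal (|y i (n + k) / s| ^ p (n + k)) :=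
          ENNReal.tsum_mul_left
      _ ≤ ENNReal.ofReal η * 1 := by
          gcongr
          refine le_trans (ENNReal.tsum_comp_le_tsum_of_injective (add_left_injective k)
            (fun n => ENNReal.ofReal (|y i n / s| ^ p n))) ?_
          exact modular_le_one_of_norm_lt ((hM i).trans_lt hMs)
      _ = ENNReal.ofReal η := mul_one _
  filter_upwards [hhead] with i hi
  refine norm_le_of_modular_le ht0 ?_
  unfold nakanoModular
  rw [← ENNReal.summable.sum_add_tsum_nat_add' (k := k)]
  refine (add_le_add hi (htail i)).trans ?_
  rw [← ENNReal.ofReal_add (by positivity) hη0.le, ENNReal.ofReal_le_one, hη]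
  linarith

/-- Adding a bounded, coordinatewise null sequence to a vector of `h_(pₙ)` produces, in the limit,
norms no larger than the maximum of the two bounds. As `pₙ → ∞`, a vector supported far out and of
norm smaller than `t` has a negligible modular at scale `t`. -/
theorem eventually_norm_add_le (hlim : Tendsto p atTop atTop) {w : NakanoSpace p hp}
    (hw : w ∈ restrictedNakanoSpace p hp) {ι : Type*} {l : Filter ι} {y : ι → NakanoSpace p hp}
    (hy : ∀ n, Tendsto (fun i => y i n) l (𝓝 0)) {M t : ℝ} (hM : ∀ i, ‖y i‖ ≤ M)
    (hwt : ‖w‖ < t) (hMt : M < t) : ∀ᶠ i in l, ‖w + y i‖ ≤ t := by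
  obtain ⟨ε, hε0, hε1, hε2⟩ : ∃ ε > 0, ‖w‖ + ε < t - ε ∧ M < t - ε :=
    ⟨(t - max ‖w‖ M) / 3, by linarith [max_lt hwt hMt], by
      linarith [max_lt hwt hMt, le_max_left ‖w‖ M], by
      linarith [max_lt hwt hMt, le_max_right ‖w‖ M]⟩
  obtain ⟨w', hw', hd⟩ := Metric.mem_closure_iff.1 hw ε hε0
  rw [dist_eq_norm] at hd
  obtain ⟨m, hm⟩ := exists_forall_ge_eq_zero_of_mem_span hw'
  have hw't : ‖w'‖ < t - ε := by
    have := norm_sub_norm_le w' w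
    rw [norm_sub_rev] at this
    linarith
  filter_upwards [eventually_norm_add_le_of_finite_support hlim hm hy hM hw't hε2] with i hi
  calc ‖w + y i‖ = ‖(w - w') + (w' + y i)‖ := by congr 1; abel
    _ ≤ ‖w - w'‖ + ‖w' + y i‖ := norm_add_le _ _
    _ ≤ t := by linarith

/-- A bounded, coordinatewise null sequence in `h_(pₙ)` has arbitrarily long bounded subsums. -/
theorem exists_card_eq_norm_sum_lt (hlim : Tendsto p atTop atTop) {y : ℕ → NakanoSpace p hp}
    (hyh : ∀ k, y k ∈ restrictedNakanoSpace p hp)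
    (hy : ∀ n, Tendsto (fun k => y k n) atTop (𝓝 0)) {M M' : ℝ} (hM0 : 0 ≤ M)
    (hM : ∀ k, ‖y k‖ ≤ M) (hMM' : M < M') (N : ℕ) :
    ∃ S : Finset ℕ, S.card = N ∧ ‖∑ k ∈ S, y k‖ < M' := by
  induction N with
  | zero => exact ⟨∅, rfl, by simpa using hM0.trans_lt hMM'⟩
  | succ N ih =>
    obtain ⟨S, hS, hlt⟩ := ih
    obtain ⟨t, ht, htM'⟩ := exists_between (max_lt hlt hMM')
    have hev := eventually_norm_add_le hlim (Submodule.sum_mem _ fun k _ => hyh k) hy hM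
      ((le_max_left _ _).trans_lt ht) ((le_max_right _ _).trans_lt ht)
    obtain ⟨k, hk, hkS⟩ := (hev.and (eventually_gt_atTop (S.sup id))).exists
    have hkS' : k ∉ S := fun h => absurd (Finset.le_sup (f := id) h) (not_le.2 hkS)
    refine ⟨insert k S, by rw [Finset.card_insert_of_notMem hkS', hS], ?_⟩
    rw [Finset.sum_insert hkS', add_comm]
    exact hk.trans_lt htM'

end NakanoSpace

/-- Of a greedy basis of a subspace of `h_(pₙ)`, take a coordinatewise convergent subsequence; the
differences of consecutive terms have long bounded sums, and by unconditionality one half of each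
difference may be dropped. -/
theorem IsGreedyBasis.exists_card_eq_norm_sum_le {Z : Type*} [NormedAddCommGroup Z]
    [NormedSpace ℝ Z] {b : SchauderBasis ℝ Z} (hb : IsGreedyBasis b)
    (hlim : Tendsto p atTop atTop) (J : Z →ₗᵢ[ℝ] NakanoSpace p hp)
    (hJ : ∀ z, J z ∈ restrictedNakanoSpace p hp) :
    ∃ K : ℝ, ∀ N : ℕ, ∃ A : Finset ℕ, A.card = N ∧ ‖∑ n ∈ A, b n‖ ≤ K := by
  obtain ⟨C, hC0, hC⟩ := hb.exists_norm_sum_le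
  obtain ⟨⟨c, M, hc, hbn⟩, -⟩ := hb
  have hM0 : 0 ≤ M := (norm_nonneg _).trans (hbn 0).2
  obtain ⟨a, -, φ, hφ, ha⟩ := (isCompact_univ_pi fun _ : ℕ =>
    isCompact_Icc (a := -M) (b := M)).tendsto_subseq
    (x := fun n => (J (b n) : ℕ → ℝ)) fun n m _ => by
      refine abs_le.1 ?_
      exact ((J (b n)).abs_apply_le_norm m).trans (by rw [J.norm_map]; exact (hbn n).2)
  rw [tendsto_pi_nhds] at ha
  set v : ℕ → Z := fun k => b (φ (2 * k)) - b (φ (2 * k + 1)) with hv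
  have h2 : Tendsto (fun k : ℕ => 2 * k) atTop atTop :=
    tendsto_id.const_mul_atTop' two_pos
  have hnull : ∀ n, Tendsto (fun k => J (v k) n) atTop (𝓝 0) := fun n => by
    have h := ((ha n).comp h2).sub ((ha n).comp ((tendsto_add_atTop_nat 1).comp h2))
    rw [sub_self] at h
    refine h.congr fun k => ?_
    rw [hv, map_sub, NakanoSpace.sub_apply]
    rfl
  have hbd : ∀ k, ‖J (v k)‖ ≤ 2 * M := fun k => by
    rw [J.norm_map, two_mul]
    exact (norm_sub_le _ _).trans (add_le_add (hbn _).2 (hbn _).2)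
  refine ⟨C * (2 * M + 1), fun N => ?_⟩
  obtain ⟨S, hS, hSlt⟩ := NakanoSpace.exists_card_eq_norm_sum_lt hlim (fun k => hJ (v k)) hnull
    (by positivity) hbd (lt_add_one _) N
  have hinj : Function.Injective fun k => φ (2 * k) := fun i j h => by
    have := hφ.injective h
    omega
  refine ⟨S.image fun k => φ (2 * k), by rw [Finset.card_image_of_injective _ hinj, hS], ?_⟩
  rw [← map_sum, J.norm_map] at hSlt
  have h := hC (∑ k ∈ S, v k) (S.image fun k => φ (2 * k))
  have e : ∑ n ∈ S.image (fun k => φ (2 * k)), b.coord n (∑ k ∈ S, v k) • b n =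
      ∑ n ∈ S.image (fun k => φ (2 * k)), b n := by
    refine Finset.sum_congr rfl fun n hn => ?_
    obtain ⟨j, hj, rfl⟩ := Finset.mem_image.1 hn
    have h1 : b.coord (φ (2 * j)) (∑ k ∈ S, v k) = ∑ k ∈ S, if j = k then (1 : ℝ) else 0 := by
      rw [map_sum]
      refine Finset.sum_congr rfl fun k _ => ?_
      rw [hv, map_sub, schauder_coord_apply, schauder_coord_apply]
      simp [hφ.injective.eq_iff, show ¬ 2 * j = 2 * k + 1 by omega]
    rw [h1, Finset.sum_ite_eq, if_pos hj, one_smul]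
  rw [e] at h
  exact h.trans (mul_le_mul_of_nonneg_left hSlt.le hC0)

end GreedyInNakano

/-! ### The unit vectors when `h_(pₙ)` is isomorphic to `c₀` -/

section UnitVectorBasis

namespace NakanoSpace

variable {p : ℕ → ℝ} {hp : ∀ n, 1 ≤ p n}

/-- If `y + x` and `y - x` lie in a ball, so does `y` with its `k`-th coordinate replaced by that of
`x`: it is the mean of `y + x` and of `y - x` with the sign of the `k`-th coordinate changed. -/
theorem norm_replace_coord_le {x y : NakanoSpace p hp} {R : ℝ} (hadd : ‖y + x‖ ≤ R)
    (hsub : ‖y - x‖ ≤ R) (k : ℕ) : ‖y + (x k - y k) • unit p hp k‖ ≤ R := by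
  have hflip : ‖(y - x) - (2 * (y k - x k)) • unit p hp k‖ ≤ R := by
    refine (norm_mono fun n => ?_).trans hsub
    rw [sub_apply, smul_apply, sub_apply, unit_apply]
    split_ifs with h
    · rw [h, ← abs_neg]
      exact le_of_eq (by congr 1; ring)
    · simp
  have e : y + (x k - y k) • unit p hp k =
      (1 / 2 : ℝ) • ((y + x) + ((y - x) - (2 * (y k - x k)) • unit p hp k)) := by
    module
  rw [e, norm_smul, Real.norm_of_nonneg (by norm_num)]
  linarith [norm_add_le (y + x) ((y - x) - (2 * (y k - x k)) • unit p hp k)]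

/-- If all signed sums of `x` lie in a ball, so does the diagonal `∑ n ∈ S, (x n) n • e n`. The
vector `y` is carried along for the induction on `S`. -/
theorem norm_add_sum_diag_le (S : Finset ℕ) (x : ℕ → NakanoSpace p hp) (y : NakanoSpace p hp)
    {R : ℝ} (h : ∀ ε : ℕ → ℝ, (∀ n, |ε n| = 1) → ‖y + ∑ n ∈ S, ε n • x n‖ ≤ R) :
    ‖y + ∑ n ∈ S, (x n n - y n) • unit p hp n‖ ≤ R := by
  induction S using Finset.induction_on generalizing y with
  | empty => simpa using h (fun _ => 1) fun _ => abs_one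
  | insert k S hk ih =>
    have hstep : ∀ σ : ℝ, |σ| = 1 →
        ‖(y + σ • x k) + ∑ n ∈ S, (x n n - (y + σ • x k) n) • unit p hp n‖ ≤ R := by
      intro σ hσ
      refine ih _ fun ε hε => ?_
      have h' := h (Function.update ε k σ) fun n => by
        rcases eq_or_ne n k with rfl | hn
        · simpa using hσ
        · simpa [hn] using hε n
      rw [Finset.sum_insert hk, Function.update_self] at h'
      have e : ∑ n ∈ S, Function.update ε k σ n • x n = ∑ n ∈ S, ε n • x n :=
        Finset.sum_congr rfl fun n hn => by
          rw [Function.update_of_ne (ne_of_mem_of_not_mem hn hk)]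
      rwa [e, ← add_assoc] at h'
    set Y := y + ∑ n ∈ S, (x n n - y n) • unit p hp n with hY
    set X := x k - ∑ n ∈ S, x k n • unit p hp n with hX
    have hsplit : ∀ σ : ℝ, (y + σ • x k) + ∑ n ∈ S, (x n n - (y + σ • x k) n) • unit p hp n =
        Y + σ • X := fun σ => by
      have e : ∀ n, (x n n - (y + σ • x k) n) • unit p hp n =
          (x n n - y n) • unit p hp n - σ • (x k n • unit p hp n) := fun n => by
        rw [add_apply, smul_apply]; module
      simp only [e, Finset.sum_sub_distrib, ← Finset.smul_sum, hY, hX]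
      module
    have hadd : ‖Y + X‖ ≤ R := by
      have := hstep 1 abs_one
      rwa [hsplit, one_smul] at this
    have hsub : ‖Y - X‖ ≤ R := by
      have := hstep (-1) (by simp)
      rwa [hsplit, neg_one_smul, ← sub_eq_add_neg] at this
    have hfin := norm_replace_coord_le hadd hsub k
    have hYk : Y k = y k := by
      rw [hY, add_apply, sum_smul_unit_apply, if_neg hk, add_zero]
    have hXk : X k = x k k := by
      rw [hX, sub_apply, sum_smul_unit_apply, if_neg hk, sub_zero]
    rw [hYk, hXk] at hfin
    rwa [Finset.sum_insert hk, add_comm ((x k k - y k) • unit p hp k), ← add_assoc]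

theorem norm_sum_diag_le (S : Finset ℕ) (x : ℕ → NakanoSpace p hp) {R : ℝ}
    (h : ∀ ε : ℕ → ℝ, (∀ n, |ε n| = 1) → ‖∑ n ∈ S, ε n • x n‖ ≤ R) :
    ‖∑ n ∈ S, x n n • unit p hp n‖ ≤ R := by
  simpa using norm_add_sum_diag_le S x 0 (R := R) (by simpa using h)

theorem sum_unit_apply (A : Finset ℕ) (m : ℕ) :
    (∑ n ∈ A, unit p hp n) m = if m ∈ A then 1 else 0 := by
  simpa using sum_smul_unit_apply (hp := hp) A (fun _ => 1) m

theorem modular_sum_unit_div (A : Finset ℕ) (t : ℝ) :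
    nakanoModular p (fun m => (∑ n ∈ A, unit p hp n) m / t) =
      ∑ n ∈ A, ENNReal.ofReal (|1 / t| ^ p n) := by
  simp only [sum_unit_apply]
  unfold nakanoModular
  rw [tsum_eq_sum (s := A)]
  · exact Finset.sum_congr rfl fun n hn => by simp only [if_pos hn]
  · intro n hn
    simp only [if_neg hn, zero_div, abs_zero]
    rw [Real.zero_rpow (by linarith [hp n]), ENNReal.ofReal_zero]

/-- As `pₙ → ∞`, sums of a bounded number of unit vectors that lie far out have norm at most `2`. -/
theorem exists_forall_norm_sum_unit_le_two (hlim : Tendsto p atTop atTop) (L : ℕ) :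
    ∃ m, ∀ D : Finset ℕ, D.card ≤ L → (∀ n ∈ D, m ≤ n) → ‖∑ n ∈ D, unit p hp n‖ ≤ 2 := by
  have hL : (0 : ℝ) < 1 / (L + 1) := by positivity
  obtain ⟨m, hm⟩ := eventually_atTop.1 (((tendsto_rpow_atTop_of_base_lt_one (1 / 2 : ℝ)
    (by norm_num) (by norm_num)).comp hlim).eventually_le_const hL)
  refine ⟨m, fun D hD hDm => norm_le_of_modular_le two_pos ?_⟩
  rw [modular_sum_unit_div, ← ENNReal.ofReal_sum_of_nonneg (fun _ _ => by positivity),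
    ENNReal.ofReal_le_one]
  have hDL : (D.card : ℝ) ≤ L + 1 := by exact_mod_cast hD.trans (Nat.le_succ L)
  calc ∑ n ∈ D, |(1 / 2 : ℝ)| ^ p n ≤ ∑ n ∈ D, (1 / (L + 1) : ℝ) := by
        refine Finset.sum_le_sum fun n hn => ?_
        rw [abs_of_pos (by norm_num)]
        exact hm n (hDm n hn)
    _ = D.card / (L + 1) := by rw [Finset.sum_const, nsmul_eq_mul, mul_one_div]
    _ ≤ 1 := (div_le_one (by positivity)).2 hDL

theorem unit_mem_restrictedNakanoSpace (n : ℕ) : unit p hp n ∈ restrictedNakanoSpace p hp :=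
  Submodule.le_topologicalClosure _ (Submodule.subset_span ⟨n, rfl⟩)

variable (p hp) in
/-- The `n`-th unit vector as an element of `h_(pₙ)`. -/
noncomputable def unitH (n : ℕ) : restrictedNakanoSpace p hp :=
  ⟨unit p hp n, unit_mem_restrictedNakanoSpace n⟩

/-- For an operator into `c₀`, only boundedly many unit vectors that lie far out can have an image
with `j`-th coordinate larger than `δ`, and those coordinates have a bounded sum. -/
theorem exists_forall_sum_large_coord_le (hlim : Tendsto p atTop atTop)
    (T : restrictedNakanoSpace p hp →L[ℝ] C₀(ℕ, ℝ)) {C δ : ℝ} (hT : ‖T‖ ≤ C)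
    (hδ : 0 < δ) : ∃ m, ∀ A : Finset ℕ, (∀ n ∈ A, m ≤ n) → ∀ j,
      ∑ n ∈ A with δ < |T (unitH p hp n) j|, |T (unitH p hp n) j| ≤ C * 2 := by
  obtain ⟨L, hL⟩ := exists_nat_gt (C * 2 / δ)
  obtain ⟨m, hm⟩ := exists_forall_norm_sum_unit_le_two (hp := hp) hlim L
  refine ⟨m, fun A hA j => ?_⟩
  have hsmall : ∀ D ⊆ A, D.card ≤ L → ∑ n ∈ D, |T (unitH p hp n) j| ≤ C * 2 := by
    intro D hDA hD
    set s : ℕ → ℝ := fun n => SignType.sign (T (unitH p hp n) j) with hs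
    set z := ∑ n ∈ D, s n • unitH p hp n with hz
    have hz2 : ‖z‖ ≤ 2 := by
      refine le_trans ?_ (hm D hD fun n hn => hA n (hDA hn))
      have e : ((z : restrictedNakanoSpace p hp) : NakanoSpace p hp) =
          ∑ n ∈ D, s n • unit p hp n := by
        rw [hz, AddSubmonoidClass.coe_finsetSum]; rfl
      rw [Submodule.coe_norm, e]
      refine norm_mono fun n => ?_
      rw [sum_smul_unit_apply, sum_unit_apply]
      split_ifs
      · rw [hs]
        rcases lt_trichotomy (T (unitH p hp n) j) 0 with h | h | h <;> simp [h]
      · rfl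
    have e : T z j = ∑ n ∈ D, |T (unitH p hp n) j| := by
      rw [hz, map_sum, ← c0Coord_apply, map_sum]
      refine Finset.sum_congr rfl fun n _ => ?_
      rw [map_smul, map_smul, c0Coord_apply, smul_eq_mul, hs]
      exact sign_mul_self _
    rw [← e]
    calc T z j ≤ ‖T z‖ := (le_abs_self _).trans (c0_abs_apply_le_norm _ _)
      _ ≤ ‖T‖ * ‖z‖ := T.le_opNorm z
      _ ≤ C * 2 := mul_le_mul hT hz2 (norm_nonneg _) ((norm_nonneg T).trans hT)
  refine hsmall _ (Finset.filter_subset _ _) ?_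
  by_contra! hlt
  obtain ⟨D, hD, hcard⟩ := Finset.exists_subset_card_eq hlt.le
  have h1 := hsmall D (hD.trans (Finset.filter_subset _ _)) hcard.le
  have h2 : ∑ n ∈ D, δ ≤ ∑ n ∈ D, |T (unitH p hp n) j| :=
    Finset.sum_le_sum fun n hn => (Finset.mem_filter.1 (hD hn)).2.le
  rw [Finset.sum_const, nsmul_eq_mul, hcard] at h2
  rw [div_lt_iff₀ hδ] at hL
  linarith

/-- If `h_(pₙ)` is isomorphic to `c₀`, the sums of finitely many unit vectors are bounded.
Small coordinates of the images `f n` of the unit vectors are cut off. The resulting `v n` still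
recover half of the unit vectors on the diagonal, since the cut-off error is small, and far out they
have bounded signed sums. The diagonal principle `norm_sum_diag_le` then bounds the sum of the unit
vectors. -/
theorem exists_norm_sum_unit_le (hlim : Tendsto p atTop atTop)
    (e : restrictedNakanoSpace p hp ≃L[ℝ] C₀(ℕ, ℝ)) :
    ∃ K : ℝ, ∀ A : Finset ℕ, ‖∑ n ∈ A, unit p hp n‖ ≤ K := by
  set T : restrictedNakanoSpace p hp →L[ℝ] C₀(ℕ, ℝ) :=
    (e : restrictedNakanoSpace p hp →L[ℝ] C₀(ℕ, ℝ)) with hT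
  set S : C₀(ℕ, ℝ) →L[ℝ] restrictedNakanoSpace p hp :=
    (e.symm : C₀(ℕ, ℝ) →L[ℝ] restrictedNakanoSpace p hp) with hS
  have hST : ∀ x, S (T x) = x := e.symm_apply_apply
  set C := ‖S‖ + 1 with hC
  have hC0 : 0 < C := by positivity
  have hSC : ‖S‖ ≤ C := by linarith
  set δ := 1 / (2 * C) with hδ
  have hδ0 : 0 < δ := by positivity
  have hCδ : C * δ = 1 / 2 := by rw [hδ]; field_simp
  obtain ⟨m, hm⟩ := exists_forall_sum_large_coord_le hlim T le_rfl hδ0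
  set f : ℕ → C₀(ℕ, ℝ) := fun n => T (unitH p hp n) with hf
  let v : ℕ → C₀(ℕ, ℝ) := fun n => c0Mk (fun j => if δ < |f n j| then f n j else 0)
    (squeeze_zero_norm (a := fun j => |f n j|) (fun j => by split_ifs <;> simp)
      (by simpa using (c0_tendsto (f n)).abs))
  have hv : ∀ n j, v n j = if δ < |f n j| then f n j else 0 := fun _ _ => rfl
  have hfv : ∀ n, ‖f n - v n‖ ≤ δ := fun n => (c0_norm_le hδ0.le).2 fun j => by
    rw [ZeroAtInftyContinuousMap.sub_apply, hv]
    split_ifs with h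
    · simpa using hδ0.le
    · simpa using not_lt.1 h
  have hdiag : ∀ n, 1 / 2 ≤ (S (v n) : NakanoSpace p hp) n := fun n => by
    have h1 : ‖S (f n - v n)‖ ≤ 1 / 2 := by
      rw [← hCδ]
      exact (S.le_opNorm _).trans (mul_le_mul hSC (hfv n) (norm_nonneg _) hC0.le)
    have h2 := (abs_apply_le_norm (S (f n - v n) : NakanoSpace p hp) n).trans h1
    have h3 : (S (f n - v n) : NakanoSpace p hp) n = 1 - (S (v n) : NakanoSpace p hp) n := by
      rw [map_sub, hf, hST]
      change unit p hp n n - _ = _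
      rw [unit_apply, if_pos rfl]
    rw [h3] at h2
    linarith [le_abs_self (1 - (S (v n) : NakanoSpace p hp) n)]
  have hfar : ∀ A : Finset ℕ, (∀ n ∈ A, m ≤ n) →
      ‖∑ n ∈ A, unit p hp n‖ ≤ 2 * (C * (‖T‖ * 2)) := by
    intro A hA
    have hsigned : ∀ ε : ℕ → ℝ, (∀ n, |ε n| = 1) →
        ‖∑ n ∈ A, ε n • (S (v n) : NakanoSpace p hp)‖ ≤ C * (‖T‖ * 2) := by
      intro ε hε
      have e1 : ∑ n ∈ A, ε n • (S (v n) : NakanoSpace p hp) =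
          (S (∑ n ∈ A, ε n • v n) : NakanoSpace p hp) := by
        rw [map_sum, AddSubmonoidClass.coe_finsetSum]
        exact Finset.sum_congr rfl fun n _ => by rw [map_smul]; rfl
      rw [e1]
      refine (S.le_opNorm _).trans (mul_le_mul hSC ?_ (norm_nonneg _) hC0.le)
      refine (c0_norm_le (by positivity)).2 fun j => ?_
      rw [← c0Coord_apply, map_sum]
      refine (Finset.abs_sum_le_sum_abs _ _).trans (le_of_eq_of_le ?_ (hm A hA j))
      rw [Finset.sum_filter]
      refine Finset.sum_congr rfl fun n _ => ?_
      rw [map_smul, smul_eq_mul, abs_mul, hε, one_mul, c0Coord_apply, hv]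
      change |if δ < |f n j| then f n j else 0| = if δ < |f n j| then |f n j| else 0
      split_ifs <;> simp
    have hd := norm_sum_diag_le A _ hsigned
    have hle : ‖∑ n ∈ A, unit p hp n‖ ≤
        ‖(2 : ℝ) • ∑ n ∈ A, (S (v n) : NakanoSpace p hp) n • unit p hp n‖ := by
      refine norm_mono fun n => ?_
      rw [smul_apply, sum_smul_unit_apply, sum_unit_apply]
      split_ifs
      · rw [abs_one]
        exact le_trans (by linarith [hdiag n]) (le_abs_self _)
      · simp
    rw [norm_smul, Real.norm_of_nonneg two_pos.le] at hle
    linarith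
  refine ⟨‖∑ n ∈ Finset.range m, unit p hp n‖ + 2 * (C * (‖T‖ * 2)), fun A => ?_⟩
  rw [← Finset.sum_filter_add_sum_filter_not A (fun n => n < m)]
  refine (norm_add_le _ _).trans (add_le_add (norm_mono fun n => ?_) (hfar _ fun n hn =>
    not_lt.1 (Finset.mem_filter.1 hn).2))
  rw [sum_unit_apply, sum_unit_apply]
  by_cases hn : n < m
  · rw [if_pos (Finset.mem_range.2 hn)]
    split_ifs <;> simp
  · rw [if_neg (show n ∉ A.filter fun n => n < m from fun h => hn (Finset.mem_filter.1 h).2)]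
    simp

theorem tendsto_zero_of_mem_restrictedNakanoSpace {x : NakanoSpace p hp}
    (hx : x ∈ restrictedNakanoSpace p hp) : Tendsto (x : ℕ → ℝ) atTop (𝓝 0) := by
  rw [Metric.tendsto_atTop]
  intro ε hε
  obtain ⟨w, hw, hd⟩ := Metric.mem_closure_iff.1 hx ε hε
  obtain ⟨m, hm⟩ := exists_forall_ge_eq_zero_of_mem_span hw
  refine ⟨m, fun n hn => ?_⟩
  have h := (abs_apply_le_norm (x - w) n).trans_lt (by rwa [← dist_eq_norm])
  rw [sub_apply, hm n hn] at h
  exact h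

variable (p hp) in
/-- The inclusion of `h_(pₙ)` into `c₀`. -/
noncomputable def inclC0 : restrictedNakanoSpace p hp →L[ℝ] C₀(ℕ, ℝ) :=
  LinearMap.mkContinuous
    { toFun := fun x => c0Mk (x : NakanoSpace p hp) (tendsto_zero_of_mem_restrictedNakanoSpace x.2)
      map_add' := fun _ _ => rfl
      map_smul' := fun _ _ => rfl } 1 fun x => by
        rw [one_mul]
        exact (c0_norm_le (norm_nonneg _)).2 fun n => abs_apply_le_norm (x : NakanoSpace p hp) n

theorem norm_inclC0_le (x : restrictedNakanoSpace p hp) : ‖inclC0 p hp x‖ ≤ ‖x‖ :=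
  (c0_norm_le (norm_nonneg _)).2 fun n => abs_apply_le_norm (x : NakanoSpace p hp) n

theorem inclC0_injective : Function.Injective (inclC0 p hp) := fun _ _ h =>
  Subtype.ext (ext fun n => DFunLike.congr_fun h n)

theorem range_coe_eq_range_coe_iff :
    Set.range (fun x : restrictedNakanoSpace p hp => ((x : NakanoSpace p hp) : ℕ → ℝ)) =
      Set.range (fun f : C₀(ℕ, ℝ) => (f : ℕ → ℝ)) ↔ Function.Surjective (inclC0 p hp) := by
  constructor
  · intro h f
    obtain ⟨x, hx⟩ := h.ge ⟨f, rfl⟩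
    exact ⟨x, DFunLike.coe_injective hx⟩
  · intro h
    refine Set.Subset.antisymm ?_ ?_
    · rintro _ ⟨x, rfl⟩
      exact ⟨inclC0 p hp x, rfl⟩
    · rintro _ ⟨f, rfl⟩
      obtain ⟨x, rfl⟩ := h f
      exact ⟨x, rfl⟩

/-- If the sums of finitely many unit vectors are bounded, a constant sequence has finite modular, so
the norm is dominated by the supremum norm and every null sequence belongs to `h_(pₙ)`. -/
theorem inclC0_surjective_of_norm_sum_unit_le {K : ℝ}
    (hK : ∀ A : Finset ℕ, ‖∑ n ∈ A, unit p hp n‖ ≤ K) : Function.Surjective (inclC0 p hp) := by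
  have hK0 : 0 ≤ K := (norm_nonneg _).trans (hK ∅)
  have hmod : ∀ (x : ℕ → ℝ) (s : ℝ), 0 < s → (∀ n, |x n| ≤ s) →
      nakanoModular p (fun n => x n / (s * (K + 1))) ≤ 1 := by
    intro x s hs hx
    refine (nakanoModular_mono hp (b := fun _ => 1 / (K + 1)) fun n => ?_).trans ?_
    · rw [abs_div, abs_mul, abs_of_pos hs, ← div_div, abs_div, abs_one]
      exact div_le_div_of_nonneg_right ((div_le_one hs).2 (hx n)) (abs_nonneg _)
    · unfold nakanoModular
      rw [ENNReal.tsum_eq_iSup_sum]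
      refine iSup_le fun A => ?_
      rw [← modular_sum_unit_div (hp := hp)]
      exact modular_le_one_of_norm_lt ((hK A).trans_lt (lt_add_one K))
  intro f
  let x : NakanoSpace p hp := ⟨f, (‖f‖ + 1) * (K + 1), by positivity,
    (hmod f _ (by positivity) fun n => (c0_abs_apply_le_norm f n).trans
      (le_add_of_nonneg_right zero_le_one)).trans_lt ENNReal.one_lt_top⟩
  have hxf : ∀ n, x n = f n := fun _ => rfl
  have hx : x ∈ restrictedNakanoSpace p hp := by
    refine Metric.mem_closure_iff.2 fun ε hε => ?_
    have hs : 0 < ε / (2 * (K + 1)) := by positivity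
    obtain ⟨N, hN⟩ := Metric.tendsto_atTop.1 (c0_tendsto f) _ hs
    refine ⟨∑ n ∈ Finset.range N, f n • unit p hp n, Submodule.sum_mem _ fun n _ =>
      Submodule.smul_mem _ _ (Submodule.subset_span ⟨n, rfl⟩), ?_⟩
    rw [dist_eq_norm]
    refine lt_of_le_of_lt (norm_le_of_modular_le (by positivity) (hmod _ _ hs fun n => ?_)) ?_
    · rw [sub_apply, sum_smul_unit_apply, hxf]
      split_ifs with hn
      · simpa using hs.le
      · simpa using (hN n (by simpa using hn)).le
    · have : ε / (2 * (K + 1)) * (K + 1) = ε / 2 := by field_simp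
      linarith
  exact ⟨⟨x, hx⟩, rfl⟩

end NakanoSpace

end UnitVectorBasis

/-! ### Subspaces with a greedy basis -/

section Conclusion

variable {p : ℕ → ℝ} {hp : ∀ n, 1 ≤ p n}

instance instCompleteSpaceRestrictedNakanoSpace : CompleteSpace (restrictedNakanoSpace p hp) :=
  (Submodule.isClosed_topologicalClosure _).completeSpace_coe

theorem IsGreedyBasis.areEquivalentSequences_c0Unit_of_nakano {Z : Type*} [NormedAddCommGroup Z]
    [NormedSpace ℝ Z] {b : SchauderBasis ℝ Z} (hb : IsGreedyBasis b)
    (hlim : Tendsto p atTop atTop) (J : Z →ₗᵢ[ℝ] restrictedNakanoSpace p hp) :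
    AreEquivalentSequences b c0Unit := by
  obtain ⟨K, hK⟩ := hb.exists_card_eq_norm_sum_le hlim
    ((restrictedNakanoSpace p hp).subtypeₗᵢ.comp J) fun z => (J z).2
  exact hb.areEquivalentSequences_c0Unit hK

/-- The inclusion of `h_(pₙ)` into `c₀` as an isomorphism, in case it is onto; its inverse is
continuous by the open mapping theorem. -/
noncomputable def NakanoSpace.equivC0 (h : Function.Surjective (NakanoSpace.inclC0 p hp)) :
    restrictedNakanoSpace p hp ≃L[ℝ] C₀(ℕ, ℝ) :=
  ContinuousLinearEquiv.ofBijective (NakanoSpace.inclC0 p hp)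
    (LinearMap.ker_eq_bot.2 NakanoSpace.inclC0_injective) (LinearMap.range_eq_top.2 h)

end Conclusion

theorem mainTheorem12 (p : ℕ → ℝ) (hp : ∀ n, 1 ≤ p n) (hlim : Tendsto p atTop atTop) :
    -- every greedy basic sequence is equivalent to the unit vector basis of `c₀`
    (∀ x : ℕ → restrictedNakanoSpace p hp,
      IsGreedyBasicSequence x → AreEquivalentSequences x c0Unit) ∧
    -- a (closed) subspace has a greedy basis iff it is isomorphic to `c₀`
    (∀ Y : Submodule ℝ (restrictedNakanoSpace p hp), IsClosed (Y : Set (restrictedNakanoSpace p hp)) →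
      (HasGreedyBasis Y ↔ Nonempty (Y ≃L[ℝ] C₀(ℕ, ℝ)))) ∧
    -- the whole space has a greedy basis iff it consists of the same sequences as `c₀` ...
    (HasGreedyBasis (restrictedNakanoSpace p hp) ↔
      Set.range (fun x : restrictedNakanoSpace p hp => ((x : NakanoSpace p hp) : ℕ → ℝ)) =
        Set.range (fun f : C₀(ℕ, ℝ) => (f : ℕ → ℝ))) ∧
    -- ... and in that case the two norms are equivalent
    (Set.range (fun x : restrictedNakanoSpace p hp => ((x : NakanoSpace p hp) : ℕ → ℝ)) =
        Set.range (fun f : C₀(ℕ, ℝ) => (f : ℕ → ℝ)) →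
      ∃ C : ℝ, 1 ≤ C ∧ ∀ (x : restrictedNakanoSpace p hp) (f : C₀(ℕ, ℝ)),
        ((x : NakanoSpace p hp) : ℕ → ℝ) = f → C⁻¹ * ‖f‖ ≤ ‖x‖ ∧ ‖x‖ ≤ C * ‖f‖) := by
  refine ⟨?_, ?_, ?_, ?_⟩
  · rintro x ⟨b, hbx, hb⟩
    obtain ⟨C, hC1, hC⟩ := hb.areEquivalentSequences_c0Unit_of_nakano hlim
      (Submodule.span ℝ (Set.range x)).topologicalClosure.subtypeₗᵢ
    refine ⟨C, hC1, fun N a => ?_⟩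
    have e : ‖∑ n ∈ Finset.range N, a n • x n‖ = ‖∑ n ∈ Finset.range N, a n • b n‖ := by
      simp only [← hbx, ← Submodule.coe_smul, ← AddSubmonoidClass.coe_finsetSum,
        ← Submodule.coe_norm]
    rw [e]
    exact hC N a
  · intro Y hY
    have : CompleteSpace Y := hY.completeSpace_coe
    refine ⟨fun ⟨b, hb⟩ => ?_, fun ⟨e⟩ => hasGreedyBasis_of_equiv_c0 e⟩
    exact nonempty_equiv_c0_of_areEquivalentSequences (Z := Y) (b := b)
      (IsGreedyBasis.areEquivalentSequences_c0Unit_of_nakano (Z := Y) hb hlim Y.subtypeₗᵢ)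
  · rw [NakanoSpace.range_coe_eq_range_coe_iff]
    refine ⟨fun ⟨b, hb⟩ => ?_, fun h => hasGreedyBasis_of_equiv_c0 (NakanoSpace.equivC0 h)⟩
    obtain ⟨e⟩ := nonempty_equiv_c0_of_areEquivalentSequences
      (hb.areEquivalentSequences_c0Unit_of_nakano hlim LinearIsometry.id)
    obtain ⟨K, hK⟩ := NakanoSpace.exists_norm_sum_unit_le hlim e
    exact NakanoSpace.inclC0_surjective_of_norm_sum_unit_le hK
  · intro h
    have hsurj := NakanoSpace.range_coe_eq_range_coe_iff.1 h
    set S : C₀(ℕ, ℝ) →L[ℝ] restrictedNakanoSpace p hp :=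
      ((NakanoSpace.equivC0 hsurj).symm : C₀(ℕ, ℝ) →L[ℝ] restrictedNakanoSpace p hp)
    refine ⟨max 1 ‖S‖, le_max_left _ _, fun x f hxf => ?_⟩
    have hf : f = NakanoSpace.inclC0 p hp x := DFunLike.coe_injective hxf.symm
    constructor
    · rw [hf]
      exact (mul_le_of_le_one_left (norm_nonneg _) (inv_le_one_of_one_le₀ (le_max_left _ _))).trans
        (NakanoSpace.norm_inclC0_le x)
    · have hSf : S f = x := by
        rw [hf]
        exact (NakanoSpace.equivC0 hsurj).symm_apply_apply x
      rw [← hSf]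
      exact (S.le_opNorm f).trans (mul_le_mul_of_nonneg_right (le_max_right _ _) (norm_nonneg _))
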